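/- Let $z>0$ and let $A$ and $B$ be $C^2$ convex closed plane curves (simple closed regular $C^2$ curves lying on one side of each of their tangent lines; flat parts are allowed), parametrized counterclockwise by arc length as $\alpha(s)$ and $b(t)$. Place $B$ (the base) in the $xy$-plane and $A$ (the top) in the parallel plane at height $z$; no nesting condition is imposed on $B$ and the projection $A_0$ of $A$ to the $xy$-plane. The smooth prismatoid $\mathcal P$ is the convex hull of the two placed curves. A rib is a segment $ab$ with $a\in A$, $b\in B$ whose two endpoints lie in a common supporting plane of $\mathcal P$. Write $a_0$ for the projection of $a$ to the $xy$-plane. The side of $\mathcal P$ is unfolded by rotating each rib $ab$ about the tangent to $B$ at $b$ into the $xy$-plane, to the side of this tangent away from $B$. The image $u$ of $a$ is the tip of the unfolded rib, and $U$ is the set of all tips. For a chosen rib $\hat a\hat b$ with tip $\hat u$, the volcano unfolding with top attached at $\hat a\hat b$ keeps the base region fixed, unfolds all ribs, and attaches the top region at $\hat u$. That is, the top is rotated about its tangent at $\hat a$ into the supporting plane containing the rib, extending beyond the rib, and then rotated with the rib about the tangent to $B$ at $\hat b$. The unfolding is nonoverlapping if distinct points of the surface (base region, ribs, top region) never land on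 the same point of the plane. Theorem. There is a rib at which $|u-a_0|$ attains its maximum over all ribs. For every such rib $\hat a\hat b$, with tip $\hat u$: 1. (Mutual tangency) The set $U$ has a tangent line at $\hat u$, in the sense that its tangent cone there (allowing both signs) is a line, and this line is parallel to the tangent of $A$ at $\hat a$. In particular, if the ribs $a(t)b(t)$ are selected as a function of $t$ with $\hat a\hat b=a(\hat t)b(\hat t)$, and the tip $u(t)$ is differentiable at $\hat t$, then $\dot u(\hat t)$ is parallel to the tangent of $A$ at $\hat a$. 2. The tip $\hat u$ lies on the boundary of the convex hull of $U$. 3. The volcano unfolding with the top attached at $\hat a\hat b$ is nonoverlapping. In particular, every smooth prismatoid has a nonoverlapping volcano unfolding. -/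

import Mathlib

open scoped RealInnerProductSpace

noncomputable section

/-- The Euclidean plane, identified with the base plane (the `xy`-plane). -/
abbrev Plane : Type := EuclideanSpace ℝ (Fin 2)

/-- Euclidean space. -/
abbrev Space : Type := EuclideanSpace ℝ (Fin 3)

/-- The point at height `z` above the point `p` of the base plane. -/
def lift (z : ℝ) (p : Plane) : Space := !₂[p 0, p 1, z]

/-- Orthogonal projection of a point of space to the base plane. -/
def shadow (q : Space) : Plane := !₂[q 0, q 1]

/-- The vector `v` turned clockwise by a right angle. -/
def rightNormal (v : Plane) : Plane := !₂[v 1, -v 0]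

/-- `γ` is an arc-length parametrization, of period `L`, of a `C²` convex closed curve: a simple
closed `C²` curve which is traversed counterclockwise and lies, for each of its tangent lines, in
the closed half-plane to the left of that line. No strict convexity is required. -/
structure IsSmoothConvexCurve (γ : ℝ → Plane) (L : ℝ) : Prop where
  period_pos : 0 < L
  periodic : Function.Periodic γ L
  simple : Set.InjOn γ (Set.Ico 0 L)
  smooth : ContDiff ℝ 2 γ
  unit_speed : ∀ t, ‖deriv γ t‖ = 1
  convex : ∀ s t, ⟪γ s - γ t, rightNormal (deriv γ t)⟫ ≤ 0

/-- The plane region bounded by a convex curve. -/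
def region (γ : ℝ → Plane) : Set Plane := convexHull ℝ (Set.range γ)

/-- The smooth prismatoid with base curve `β` at height `0` and top curve `α` at height `z`. -/
def prismatoid (α β : ℝ → Plane) (z : ℝ) : Set Space :=
  convexHull ℝ (lift z '' Set.range α ∪ lift 0 '' Set.range β)

/-- The segment from the top point `α s` (at height `z`) to the base point `β t` is a rib: some
supporting plane `H` of the prismatoid (with outer normal `N`) contains both its endpoints. -/
def IsRib (α β : ℝ → Plane) (z s t : ℝ) : Prop :=
  ∃ N : Space, N ≠ 0 ∧
    (∀ x ∈ prismatoid α β z, ⟪N, x⟫ ≤ ⟪N, lift z (α s)⟫) ∧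
    (∀ x ∈ prismatoid α β z, ⟪N, x⟫ ≤ ⟪N, lift 0 (β t)⟫)

/-- The rib itself, as a segment in space. -/
def rib (α β : ℝ → Plane) (z s t : ℝ) : Set Space :=
  segment ℝ (lift z (α s)) (lift 0 (β t))

/-- The image of `q` under the rotation about the tangent to the base at `β t` which brings `q`
into the base plane, on the side of that tangent away from the base. The rotation keeps the
coordinate along the tangent and the distance to the tangent. -/
def unfoldPoint (β : ℝ → Plane) (t : ℝ) (q : Space) : Plane :=
  β t + ⟪shadow q - β t, deriv β t⟫ • deriv β t
    + √(⟪shadow q - β t, rightNormal (deriv β t)⟫ ^ 2 + q 2 ^ 2) • rightNormal (deriv β t)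

/-- The tip `u` of the unfolded rib from `α s` to `β t`. -/
def tip (α β : ℝ → Plane) (z s t : ℝ) : Plane := unfoldPoint β t (lift z (α s))

/-- The side unfolding `U`: the set of tips of all unfolded ribs. -/
def sideUnfolding (α β : ℝ → Plane) (z : ℝ) : Set Plane :=
  {u | ∃ s t, IsRib α β z s t ∧ u = tip α β z s t}

/-- Where the point of the top above `p` lands when the top is attached to the tip of the unfolded
rib from `α s` to `β t`. The top is first rotated about its tangent at `α s` into the supporting
plane containing the rib (so as to extend beyond the rib), and then rotated together with the rib
about the tangent at `β t`. The two tangents are parallel, so coordinates along the common tangent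
direction are kept, and the inward direction of the top becomes the outward normal direction. -/
def flipOut (α β : ℝ → Plane) (z s t : ℝ) (p : Plane) : Plane :=
  tip α β z s t + ⟪p - α s, deriv β t⟫ • deriv β t
    - ⟪p - α s, rightNormal (deriv β t)⟫ • rightNormal (deriv β t)

/-- `Lands α β z s₀ t₀ q p`: in the volcano unfolding whose top is attached to the rib from `α s₀`
to `β t₀`, the point `q` of the surface of the prismatoid lands on the point `p` of the base plane.
The base stays, every rib is unfolded about its base tangent, and the top is flipped out. -/
inductive Lands (α β : ℝ → Plane) (z s₀ t₀ : ℝ) : Space → Plane → Prop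
  | base (p : Plane) (hp : p ∈ region β) : Lands α β z s₀ t₀ (lift 0 p) p
  | side (s t : ℝ) (h : IsRib α β z s t) (q : Space) (hq : q ∈ rib α β z s t) :
      Lands α β z s₀ t₀ q (unfoldPoint β t q)
  | top (p : Plane) (hp : p ∈ region α) :
      Lands α β z s₀ t₀ (lift z p) (flipOut α β z s₀ t₀ p)

/-- The volcano unfolding does not overlap: different points of the surface never land on the same
point of the plane. -/
def Nonoverlapping (α β : ℝ → Plane) (z s₀ t₀ : ℝ) : Prop :=
  ∀ (q q' : Space) (p : Plane), Lands α β z s₀ t₀ q p → Lands α β z s₀ t₀ q' p → q = q'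

/-- The rib from `α s` to `β t` maximizes `|u - a₀|` among all ribs, where `u` is the tip of the
unfolded rib and `a₀` is the projection of its top endpoint to the base plane. -/
def IsMaximalRib (α β : ℝ → Plane) (z s t : ℝ) : Prop :=
  IsRib α β z s t ∧ ∀ s' t', IsRib α β z s' t' →
    ‖tip α β z s' t' - α s'‖ ≤ ‖tip α β z s t - α s‖

/-- Mutual tangency at the rib from `α s` to `β t`: the tangent line of the side unfolding at the
tip exists and is parallel to the tangent of the top at `α s`; in particular, whenever the top is
parametrized in concert with the base (by `t' ↦ α (σ t')`) and `u` is differentiable at `t` as a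
function of the base parameter, its derivative is parallel to the tangent of the top. -/
def MutualTangency (α β : ℝ → Plane) (z s t : ℝ) : Prop :=
  tangentConeAt ℝ (sideUnfolding α β z) (tip α β z s t) = (ℝ ∙ deriv α s : Submodule ℝ Plane) ∧
  ∀ σ : ℝ → ℝ, (∀ t', IsRib α β z (σ t') t') → σ t = s →
    ∀ v : Plane, HasDerivAt (fun t' => tip α β z (σ t') t') v t →
      v ∈ (ℝ ∙ deriv α s : Submodule ℝ Plane)

end

/-! Ribs join points with equal unit tangents τ, hence equal outer normals n (`isRib_iff`). If c is
the signed distance of a₀ outside the tangent at b, unfolding gives u = a₀ + f n with f = √(c² + z²)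
- c > 0 (`tip_eq`). A maximal rib is thus one with maximal f; call that value F.

Compare another rib, with data a', f', n', to a maximal one. Then ⟨u' - u, n⟩ = ⟨a' - a, n⟩ - f'(1 -
⟨n', n⟩) - (F - f'), and no term is positive: by convexity of the top, by Cauchy–Schwarz, and by
maximality (`tip_inner_le`). So the line through u parallel to τ supports U. This puts u on the
boundary of the hull and separates the flipped top from the ribs; the equality case shows that they
touch only where they agree in space (`eq_lift_of_pointOnRib`).

For tangency, the height ⟨u' - u, n⟩ is squeezed between 0 and a differentiable function with
maximum 0, obtained by freezing the base point (`hasDerivAt_comparison`). Hence it is o(|r - s|),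
while the displacement along τ is at least |r - s| / 2 (`tip_near`).

Two unfolded ribs with different tangents do not meet away from the base: convexity bounds each
height at a meeting point, and the product of the bounds contradicts the 1-Lipschitz property of c ↦
√(c² + z²) (`deriv_eq_of_meet`). -/

open Filter Topology Set

/-! ### Orthonormal frames in the plane. -/

section Frame

lemma plane_inner_eq (v w : Plane) : ⟪v, w⟫ = v 0 * w 0 + v 1 * w 1 := by
  simp [PiLp.inner_apply, Fin.sum_univ_two, mul_comm]

@[simp] lemma rightNormal_apply_zero (v : Plane) : rightNormal v 0 = v 1 := rfl

@[simp] lemma rightNormal_apply_one (v : Plane) : rightNormal v 1 = -v 0 := rfl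

lemma rightNormal_injective : Function.Injective rightNormal := by
  intro v w h
  have h0 := congrArg (fun u : Plane => u 0) h
  have h1 := congrArg (fun u : Plane => u 1) h
  simp only [rightNormal_apply_zero, rightNormal_apply_one, neg_inj] at h0 h1
  ext i
  fin_cases i
  · exact h1
  · exact h0

lemma plane_sq_add_sq_of_norm_eq_one {v : Plane} (hv : ‖v‖ = 1) : v 0 ^ 2 + v 1 ^ 2 = 1 := by
  have h := real_inner_self_eq_norm_sq v
  rw [hv, plane_inner_eq] at h
  linarith

lemma norm_rightNormal (v : Plane) : ‖rightNormal v‖ = ‖v‖ := by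
  rw [← sq_eq_sq₀ (norm_nonneg _) (norm_nonneg _), ← real_inner_self_eq_norm_sq,
    ← real_inner_self_eq_norm_sq, plane_inner_eq, plane_inner_eq]
  simp only [rightNormal_apply_zero, rightNormal_apply_one]
  ring

lemma inner_rightNormal_self (v : Plane) : ⟪v, rightNormal v⟫ = 0 := by
  rw [plane_inner_eq]
  simp only [rightNormal_apply_zero, rightNormal_apply_one]
  ring

lemma inner_self_rightNormal (v : Plane) : ⟪rightNormal v, v⟫ = 0 := by
  rw [real_inner_comm, inner_rightNormal_self]

lemma inner_rightNormal_rightNormal (v w : Plane) :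
    ⟪rightNormal v, rightNormal w⟫ = ⟪v, w⟫ := by
  rw [plane_inner_eq, plane_inner_eq]
  simp only [rightNormal_apply_zero, rightNormal_apply_one]
  ring

lemma inner_self_of_norm_eq_one {v : Plane} (hv : ‖v‖ = 1) : ⟪v, v⟫ = 1 := by
  rw [real_inner_self_eq_norm_sq, hv, one_pow]

/-- Expansion of a vector in the orthonormal frame `τ, rightNormal τ`. -/
lemma frame_expansion {τ : Plane} (hτ : ‖τ‖ = 1) (v : Plane) :
    v = ⟪v, τ⟫ • τ + ⟪v, rightNormal τ⟫ • rightNormal τ := by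
  have h := plane_sq_add_sq_of_norm_eq_one hτ
  ext i
  fin_cases i
  · simp [plane_inner_eq]
    linear_combination -(v 0) * h
  · simp [plane_inner_eq]
    linear_combination -(v 1) * h

lemma inner_eq_frame {τ : Plane} (hτ : ‖τ‖ = 1) (v w : Plane) :
    ⟪v, w⟫ = ⟪v, τ⟫ * ⟪w, τ⟫ + ⟪v, rightNormal τ⟫ * ⟪w, rightNormal τ⟫ := by
  conv_lhs => rw [frame_expansion hτ w]
  rw [inner_add_right, real_inner_smul_right, real_inner_smul_right]
  ring

lemma frame_ext {τ : Plane} (hτ : ‖τ‖ = 1) {v w : Plane} (h : ⟪v, τ⟫ = ⟪w, τ⟫)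
    (h' : ⟪v, rightNormal τ⟫ = ⟪w, rightNormal τ⟫) : v = w := by
  rw [frame_expansion hτ v, frame_expansion hτ w, h, h']

lemma continuous_rightNormal : Continuous rightNormal := by
  unfold rightNormal
  fun_prop

lemma HasDerivAt.rightNormal {f : ℝ → Plane} {f' : Plane} {x : ℝ} (h : HasDerivAt f f' x) :
    HasDerivAt (fun t => rightNormal (f t)) (rightNormal f') x := by
  let J : Plane →ₗ[ℝ] Plane :=
    { toFun := _root_.rightNormal
      map_add' := fun v w => by
        ext i
        fin_cases i
        · simp
        · simp [add_comm]
      map_smul' := fun c v => by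
        ext i
        fin_cases i <;> simp }
  exact (LinearMap.toContinuousLinearMap J).hasFDerivAt.comp_hasDerivAt x h

end Frame

/-! ### The gap function √(c² + z²) - c. -/

section Gap

/-- For a rib whose top endpoint has signed distance `c` outside the base tangent, the distance from
the projection of its top endpoint to its unfolded tip. -/
noncomputable def gap (z c : ℝ) : ℝ := √(c ^ 2 + z ^ 2) - c

variable {z : ℝ}

lemma gap_pos (hz : 0 < z) (c : ℝ) : 0 < gap z c := by
  have : |c| < √(c ^ 2 + z ^ 2) := by
    rw [← Real.sqrt_sq_eq_abs]
    exact Real.sqrt_lt_sqrt (sq_nonneg c) (by nlinarith)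
  unfold gap
  linarith [le_abs_self c]

/-- The 1-Lipschitz property of c ↦ √(c² + z²), in a form needing no case split on the sign of c -
d. It yields monotonicity of the gap and the disjointness of ribs. -/
lemma sqrt_sub_sqrt_mul_le (c d : ℝ) :
    (c - d) * (√(c ^ 2 + z ^ 2) - √(d ^ 2 + z ^ 2)) ≤ (c - d) ^ 2 := by
  set x := √(c ^ 2 + z ^ 2)
  set y := √(d ^ 2 + z ^ 2)
  have hx : x ^ 2 = c ^ 2 + z ^ 2 := Real.sq_sqrt (by positivity)
  have hy : y ^ 2 = d ^ 2 + z ^ 2 := Real.sq_sqrt (by positivity)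
  have hx0 : 0 ≤ x := Real.sqrt_nonneg _
  have hy0 : 0 ≤ y := Real.sqrt_nonneg _
  -- Cauchy–Schwarz for the vectors (c, z) and (d, z).
  have hxy : c * d + z ^ 2 ≤ x * y := by
    refine le_of_abs_le (abs_le_of_sq_le_sq ?_ (by positivity))
    rw [mul_pow, hx, hy]
    nlinarith [sq_nonneg (z * (c - d))]
  have h : (x - y) ^ 2 ≤ (c - d) ^ 2 := by nlinarith
  nlinarith [sq_nonneg ((c - d) - (x - y))]

lemma gap_antitone : Antitone (gap z) := by
  intro c d h
  rcases h.eq_or_lt with rfl | h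
  · exact le_rfl
  have := sqrt_sub_sqrt_mul_le (z := z) d c
  have : √(d ^ 2 + z ^ 2) - √(c ^ 2 + z ^ 2) ≤ d - c := by
    have h' : 0 < d - c := sub_pos.2 h
    nlinarith
  unfold gap
  linarith

lemma continuous_gap : Continuous (gap z) := by
  unfold gap
  fun_prop

lemma differentiable_gap (hz : 0 < z) : Differentiable ℝ (gap z) := by
  unfold gap
  intro c
  refine DifferentiableAt.sub (DifferentiableAt.sqrt (by fun_prop) (by positivity)) differentiableAt_id

end Gap

/-! ### Convex curves: support directions and parameters. -/

namespace IsSmoothConvexCurve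

variable {γ : ℝ → Plane} {L : ℝ}

lemma hasDerivAt (h : IsSmoothConvexCurve γ L) (t : ℝ) : HasDerivAt γ (deriv γ t) t :=
  (h.smooth.differentiable (by norm_num) t).hasDerivAt

lemma continuous (h : IsSmoothConvexCurve γ L) : Continuous γ := h.smooth.continuous

lemma differentiable_deriv (h : IsSmoothConvexCurve γ L) : Differentiable ℝ (deriv γ) := by
  have h2 : ContDiff ℝ (1 + 1) γ := by
    have : (1 + 1 : WithTop ℕ∞) = 2 := by norm_num
    rw [this]
    exact h.smooth
  exact (contDiff_succ_iff_deriv.1 h2).2.2.differentiable (by norm_num)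

lemma continuous_deriv (h : IsSmoothConvexCurve γ L) : Continuous (deriv γ) :=
  h.differentiable_deriv.continuous

lemma periodic_deriv (h : IsSmoothConvexCurve γ L) : Function.Periodic (deriv γ) L := by
  intro t
  rw [← deriv_comp_add_const, show (fun x => γ (x + L)) = γ from funext h.periodic]

lemma convex' (h : IsSmoothConvexCurve γ L) (s t : ℝ) :
    ⟪γ s, rightNormal (deriv γ t)⟫ ≤ ⟪γ t, rightNormal (deriv γ t)⟫ := by
  have := h.convex s t
  rw [inner_sub_left] at this
  linarith

lemma exists_isMax_inner (h : IsSmoothConvexCurve γ L) (m : Plane) :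
    ∃ t, ∀ s, ⟪γ s, m⟫ ≤ ⟪γ t, m⟫ := by
  have hc := h.periodic.compact_of_continuous h.period_pos.ne' h.continuous
  obtain ⟨_, ⟨t, rfl⟩, ht⟩ := hc.exists_isMaxOn (range_nonempty γ)
    (f := fun p : Plane => ⟪p, m⟫) (by fun_prop)
  exact ⟨t, fun s => ht (mem_range_self s)⟩

lemma inner_deriv_eq_zero (h : IsSmoothConvexCurve γ L) {m : Plane} {t : ℝ}
    (ht : ∀ s, ⟪γ s, m⟫ ≤ ⟪γ t, m⟫) : ⟪deriv γ t, m⟫ = 0 := by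
  have hd : HasDerivAt (fun s => ⟪γ s, m⟫) ⟪deriv γ t, m⟫ t := by
    simpa using (h.hasDerivAt t).inner ℝ (hasDerivAt_const t m)
  exact IsLocalMax.hasDerivAt_eq_zero (Eventually.of_forall ht) hd

/-- A direction in which `γ t` is extreme is the outer normal direction at `t`. -/
lemma eq_smul_rightNormal (h : IsSmoothConvexCurve γ L) {m : Plane} {t : ℝ}
    (ht : ∀ s, ⟪γ s, m⟫ ≤ ⟪γ t, m⟫) : m = ‖m‖ • rightNormal (deriv γ t) := by
  have hτ := h.unit_speed t
  have h0 := h.inner_deriv_eq_zero ht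
  have hm : m = ⟪m, rightNormal (deriv γ t)⟫ • rightNormal (deriv γ t) := by
    conv_lhs => rw [frame_expansion hτ m, real_inner_comm, h0, zero_smul, zero_add]
  have hnn : 0 ≤ ⟪m, rightNormal (deriv γ t)⟫ := by
    by_contra! hneg
    set k := ⟪m, rightNormal (deriv γ t)⟫
    -- If m pointed inward, γ t would be extreme for both n and -n, so the curve would lie on a
    -- line. Its farthest point along that line would then have zero velocity.
    have hflat : ∀ s, ⟪γ s, rightNormal (deriv γ t)⟫ = ⟪γ t, rightNormal (deriv γ t)⟫ := by
      intro s
      have h1 := ht s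
      rw [hm, real_inner_smul_right, real_inner_smul_right] at h1
      have h2 := h.convex' s t
      nlinarith
    obtain ⟨r, hr⟩ := h.exists_isMax_inner (deriv γ t)
    have h3 := h.inner_deriv_eq_zero hr
    have h4 : ⟪deriv γ r, rightNormal (deriv γ t)⟫ = 0 :=
      h.inner_deriv_eq_zero fun s => by rw [hflat s, hflat r]
    have h5 := frame_expansion hτ (deriv γ r)
    rw [h3, h4, zero_smul, zero_smul, add_zero] at h5
    have h6 := h.unit_speed r
    rw [h5, norm_zero] at h6
    exact zero_ne_one h6
  have hk : ‖m‖ = ⟪m, rightNormal (deriv γ t)⟫ := by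
    conv_lhs => rw [hm, norm_smul, norm_rightNormal, hτ, mul_one, Real.norm_of_nonneg hnn]
  rw [hk]
  exact hm

/-- The point farthest in the direction `rightNormal τ` has this outer normal. Hence every point of
one curve is the endpoint of some rib. -/
lemma exists_deriv_eq (h : IsSmoothConvexCurve γ L) {τ : Plane} (hτ : ‖τ‖ = 1) :
    ∃ t, deriv γ t = τ := by
  obtain ⟨t, ht⟩ := h.exists_isMax_inner (rightNormal τ)
  refine ⟨t, rightNormal_injective ?_⟩
  rw [h.eq_smul_rightNormal ht, norm_rightNormal, hτ, one_smul]

lemma inner_rightNormal_le_of_mem_region (h : IsSmoothConvexCurve γ L) {p : Plane}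
    (hp : p ∈ region γ) (t : ℝ) :
    ⟪p, rightNormal (deriv γ t)⟫ ≤ ⟪γ t, rightNormal (deriv γ t)⟫ := by
  have hc : Convex ℝ {q : Plane | ⟪q, rightNormal (deriv γ t)⟫ ≤ ⟪γ t, rightNormal (deriv γ t)⟫} :=
    convex_halfSpace_le ⟨fun _ _ => inner_add_left _ _ _, fun _ _ => real_inner_smul_left _ _ _⟩ _
  refine convexHull_min ?_ hc hp
  rintro _ ⟨s, rfl⟩
  exact h.convex' s t

lemma exists_eq_add_period (h : IsSmoothConvexCurve γ L) {s t : ℝ} (hst : γ s = γ t) :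
    ∃ k : ℤ, s = t + k * L := by
  have hL := h.period_pos
  have hrep : ∀ r, γ (toIcoMod hL 0 r) = γ r := fun r => by
    rw [toIcoMod, h.periodic.sub_zsmul_eq]
  have hmem : ∀ r, toIcoMod hL 0 r ∈ Ico 0 L := fun r => by
    simpa using toIcoMod_mem_Ico hL 0 r
  have heq := h.simple (hmem s) (hmem t) (by rw [hrep, hrep, hst])
  refine ⟨toIcoDiv hL 0 s - toIcoDiv hL 0 t, ?_⟩
  have h1 := toIcoMod_add_toIcoDiv_zsmul hL 0 s
  have h2 := toIcoMod_add_toIcoDiv_zsmul hL 0 t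
  rw [zsmul_eq_mul] at h1 h2
  push_cast
  linarith

/-- A point of the curve close to `γ s₀` has a parameter close to `s₀`. -/
lemma exists_near_parameter (h : IsSmoothConvexCurve γ L) (s₀ : ℝ) {ε : ℝ} (hε : 0 < ε) :
    ∃ δ > 0, ∀ s, ‖γ s - γ s₀‖ < δ → ∃ s', |s' - s₀| < ε ∧ ∃ k : ℤ, s = s' + k * L := by
  have hL := h.period_pos
  -- One period centred at s₀, without the ε-neighbourhood of s₀. By simplicity γ does not return to
  -- γ s₀ there, so compactness bounds the distance below.
  set K : Set ℝ := Icc (s₀ - L / 2) (s₀ + L / 2) ∩ {s | ε ≤ |s - s₀|} with hKdef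
  have hK : IsCompact K :=
    isCompact_Icc.inter_right (isClosed_le continuous_const (by fun_prop))
  have hpos : ∀ s ∈ K, 0 < ‖γ s - γ s₀‖ := by
    rintro s ⟨⟨hs1, hs2⟩, hs3⟩
    rw [norm_pos_iff, sub_ne_zero]
    intro heq
    obtain ⟨k, hk⟩ := h.exists_eq_add_period heq
    have hk1 : k < 1 := by
      have : (k : ℝ) < 1 := by nlinarith
      exact_mod_cast this
    have hk2 : -1 < k := by
      have : (-1 : ℝ) < k := by nlinarith
      exact_mod_cast this
    have hk0 : k = 0 := by omega
    have hs4 : ε ≤ |s - s₀| := hs3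
    rw [hk, hk0] at hs4
    simp only [Int.cast_zero, zero_mul, add_zero, sub_self, abs_zero] at hs4
    linarith
  have hδ : ∃ δ > 0, ∀ s ∈ K, δ ≤ ‖γ s - γ s₀‖ := by
    rcases K.eq_empty_or_nonempty with hE | hne
    · exact ⟨1, one_pos, fun s hs => by simp [hE] at hs⟩
    · have hcont := h.continuous
      obtain ⟨r, hr, hmin⟩ := hK.exists_isMinOn hne
        (f := fun s => ‖γ s - γ s₀‖) (by fun_prop)
      exact ⟨_, hpos r hr, fun s hs => hmin hs⟩
  obtain ⟨δ, hδ0, hδ⟩ := hδ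
  refine ⟨δ, hδ0, fun s hs => ⟨toIcoMod hL (s₀ - L / 2) s, ?_, toIcoDiv hL (s₀ - L / 2) s, ?_⟩⟩
  · by_contra! hfar
    have hmem := toIcoMod_mem_Ico hL (s₀ - L / 2) s
    have hle := hδ _ ⟨⟨hmem.1, by linarith [hmem.2]⟩, hfar⟩
    rw [toIcoMod, h.periodic.sub_zsmul_eq] at hle
    linarith
  · rw [← zsmul_eq_mul, toIcoMod_add_toIcoDiv_zsmul]

end IsSmoothConvexCurve

/-! ### Ribs, their tips, and existence of a maximal rib. -/

lemma inner_lift (N : Space) (z : ℝ) (p : Plane) : ⟪N, lift z p⟫ = ⟪p, shadow N⟫ + N 2 * z := by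
  rw [plane_inner_eq]
  simp [lift, shadow, PiLp.inner_apply, Fin.sum_univ_three]
  ring

variable {α β : ℝ → Plane} {LA LB z s t : ℝ}

/-- The ribs are the segments between points with the same tangent direction. -/
lemma isRib_iff (hα : IsSmoothConvexCurve α LA) (hβ : IsSmoothConvexCurve β LB) (hz : 0 < z) :
    IsRib α β z s t ↔ deriv α s = deriv β t := by
  constructor
  · rintro ⟨N, hN, hA, hB⟩
    have memA : ∀ r, lift z (α r) ∈ prismatoid α β z := fun r =>
      subset_convexHull _ _ (Or.inl ⟨_, mem_range_self r, rfl⟩)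
    have memB : ∀ r, lift 0 (β r) ∈ prismatoid α β z := fun r =>
      subset_convexHull _ _ (Or.inr ⟨_, mem_range_self r, rfl⟩)
    have hA' : ∀ r, ⟪α r, shadow N⟫ ≤ ⟪α s, shadow N⟫ := fun r => by
      have := hA _ (memA r)
      rw [inner_lift, inner_lift] at this
      linarith
    have hB' : ∀ r, ⟪β r, shadow N⟫ ≤ ⟪β t, shadow N⟫ := fun r => by
      have := hB _ (memB r)
      rw [inner_lift, inner_lift] at this
      linarith
    -- A vertical N would take its maximum both at height 0 and at height z, forcing N = 0.
    have h0 : ‖shadow N‖ ≠ 0 := by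
      intro h0
      rw [norm_eq_zero] at h0
      have h1 := hA _ (memB t)
      have h2 := hB _ (memA s)
      rw [inner_lift, inner_lift, h0] at h1 h2
      simp only [inner_zero_right] at h1 h2
      have h3 : N 2 = 0 := by nlinarith
      refine hN ?_
      have e0 : N 0 = 0 := congrArg (fun v : Plane => v 0) h0
      have e1 : N 1 = 0 := congrArg (fun v : Plane => v 1) h0
      ext i
      fin_cases i <;> assumption
    have := (hα.eq_smul_rightNormal hA').symm.trans (hβ.eq_smul_rightNormal hB')
    exact rightNormal_injective (smul_right_injective _ h0 this)
  · intro h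
    set n := rightNormal (deriv β t)
    -- The vertical component is chosen so that both endpoints lie at the same level of N.
    set k := (⟪β t, n⟫ - ⟪α s, n⟫) / z
    set N : Space := !₂[n 0, n 1, k]
    have hs : shadow N = n := by
      ext i
      fin_cases i <;> rfl
    have hk : k * z = ⟪β t, n⟫ - ⟪α s, n⟫ := div_mul_cancel₀ _ hz.ne'
    have hN2 : N 2 = k := rfl
    have hval : ⟪N, lift z (α s)⟫ = ⟪N, lift 0 (β t)⟫ := by
      rw [inner_lift, inner_lift, hs, hN2, hk]
      ring
    have hmax : ∀ x ∈ prismatoid α β z, ⟪N, x⟫ ≤ ⟪N, lift 0 (β t)⟫ := by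
      intro x hx
      have hc : Convex ℝ {q : Space | ⟪N, q⟫ ≤ ⟪N, lift 0 (β t)⟫} :=
        convex_halfSpace_le ⟨fun _ _ => inner_add_right _ _ _,
          fun _ _ => real_inner_smul_right _ _ _⟩ _
      refine convexHull_min ?_ hc hx
      rintro _ (⟨_, ⟨r, rfl⟩, rfl⟩ | ⟨_, ⟨r, rfl⟩, rfl⟩)
      · show ⟪N, lift z (α r)⟫ ≤ _
        rw [← hval, inner_lift, inner_lift, hs]
        have := hα.convex' r s
        rw [h] at this
        linarith
      · show ⟪N, lift 0 (β r)⟫ ≤ _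
        rw [inner_lift, inner_lift, hs]
        have := hβ.convex' r t
        linarith
    refine ⟨N, ?_, fun x hx => (hmax x hx).trans_eq hval.symm, hmax⟩
    intro h0
    have hn : ‖n‖ = 1 := by rw [norm_rightNormal, hβ.unit_speed]
    rw [← hs, h0] at hn
    have : shadow 0 = 0 := by
      ext i
      fin_cases i <;> rfl
    rw [this, norm_zero] at hn
    exact zero_ne_one hn

/-- The signed distance of the top endpoint of the rib beyond the tangent to the base. -/
noncomputable def ribOffset (α β : ℝ → Plane) (s t : ℝ) : ℝ :=
  ⟪α s - β t, rightNormal (deriv β t)⟫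

/-- The rotation keeps the coordinate along the base tangent and turns the normal coordinate c into
√(c² + z²), so tip and projection differ only along the normal. -/
lemma tip_eq (hβ : IsSmoothConvexCurve β LB) (s t : ℝ) :
    tip α β z s t = α s + gap z (ribOffset α β s t) • rightNormal (deriv β t) := by
  have hs : shadow (lift z (α s)) = α s := by
    ext i
    fin_cases i <;> rfl
  have h2 : (lift z (α s)) 2 = z := rfl
  have h : α s = β t + (⟪α s - β t, deriv β t⟫ • deriv β t
      + ⟪α s - β t, rightNormal (deriv β t)⟫ • rightNormal (deriv β t)) := by
    rw [← frame_expansion (hβ.unit_speed t), add_sub_cancel]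
  rw [tip, unfoldPoint, hs, h2, gap, ribOffset]
  generalize ⟪α s - β t, deriv β t⟫ = x at h ⊢
  generalize ⟪α s - β t, rightNormal (deriv β t)⟫ = c at h ⊢
  rw [h]
  module

lemma norm_tip_sub (hβ : IsSmoothConvexCurve β LB) (hz : 0 < z) (s t : ℝ) :
    ‖tip α β z s t - α s‖ = gap z (ribOffset α β s t) := by
  rw [tip_eq hβ, add_sub_cancel_left, norm_smul, norm_rightNormal, hβ.unit_speed, mul_one,
    Real.norm_of_nonneg (gap_pos hz _).le]

/-- Periodicity reduces ribs to a compact rectangle, in which equality of tangents is a closed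
condition. -/
lemma exists_isMaximalRib (hα : IsSmoothConvexCurve α LA) (hβ : IsSmoothConvexCurve β LB)
    (hz : 0 < z) : ∃ s t, IsMaximalRib α β z s t := by
  have h1 := hα.continuous_deriv
  have h2 := hβ.continuous_deriv
  have h3 := hα.continuous
  have h4 := hβ.continuous
  set R : Set (ℝ × ℝ) := (Icc 0 LA ×ˢ Icc 0 LB) ∩ {p | deriv α p.1 = deriv β p.2}
  have hR : IsCompact R := (isCompact_Icc.prod isCompact_Icc).inter_right
    (isClosed_eq (by fun_prop) (by fun_prop))
  have hrep : ∀ s t, deriv α s = deriv β t → ∃ p ∈ R,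
      gap z (ribOffset α β p.1 p.2) = gap z (ribOffset α β s t) := by
    intro s t hst
    obtain ⟨s', hs', e1⟩ : ∃ s' ∈ Icc 0 LA, α s = α s' ∧ deriv α s = deriv α s' := by
      have hp : Function.Periodic (fun r => (α r, deriv α r)) LA := fun r =>
        Prod.ext (hα.periodic r) (hα.periodic_deriv r)
      obtain ⟨s', hs', e⟩ := hp.exists_mem_Ico₀ hα.period_pos s
      exact ⟨s', Ico_subset_Icc_self hs', Prod.ext_iff.1 e⟩
    obtain ⟨t', ht', e2⟩ : ∃ t' ∈ Icc 0 LB, β t = β t' ∧ deriv β t = deriv β t' := by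
      have hp : Function.Periodic (fun r => (β r, deriv β r)) LB := fun r =>
        Prod.ext (hβ.periodic r) (hβ.periodic_deriv r)
      obtain ⟨t', ht', e⟩ := hp.exists_mem_Ico₀ hβ.period_pos t
      exact ⟨t', Ico_subset_Icc_self ht', Prod.ext_iff.1 e⟩
    refine ⟨(s', t'), ⟨⟨hs', ht'⟩, ?_⟩, ?_⟩
    · show deriv α s' = deriv β t'
      rw [← e1.2, ← e2.2, hst]
    · simp only [ribOffset]
      rw [e1.1, e2.1, e2.2]
  have hne : R.Nonempty := by
    obtain ⟨t, ht⟩ := hβ.exists_deriv_eq (hα.unit_speed 0)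
    obtain ⟨p, hp, -⟩ := hrep 0 t ht.symm
    exact ⟨p, hp⟩
  have hcont : Continuous fun p : ℝ × ℝ => gap z (ribOffset α β p.1 p.2) := by
    have h5 := continuous_rightNormal
    have h6 := continuous_gap (z := z)
    unfold ribOffset
    fun_prop
  obtain ⟨⟨s, t⟩, hp, hmax⟩ := hR.exists_isMaxOn hne hcont.continuousOn
  refine ⟨s, t, (isRib_iff hα hβ hz).2 hp.2, fun s' t' h => ?_⟩
  obtain ⟨q, hq, e⟩ := hrep s' t' ((isRib_iff hα hβ hz).1 h)
  rw [norm_tip_sub hβ hz, norm_tip_sub hβ hz, ← e]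
  exact hmax hq

lemma IsMaximalRib.deriv_eq (hα : IsSmoothConvexCurve α LA) (hβ : IsSmoothConvexCurve β LB)
    (hz : 0 < z) (h : IsMaximalRib α β z s t) : deriv α s = deriv β t :=
  (isRib_iff hα hβ hz).1 h.1

lemma IsMaximalRib.gap_le (hα : IsSmoothConvexCurve α LA) (hβ : IsSmoothConvexCurve β LB)
    (hz : 0 < z) (h : IsMaximalRib α β z s t) {s' t' : ℝ} (h' : deriv α s' = deriv β t') :
    gap z (ribOffset α β s' t') ≤ gap z (ribOffset α β s t) := by
  rw [← norm_tip_sub hβ hz, ← norm_tip_sub hβ hz]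
  exact h.2 s' t' ((isRib_iff hα hβ hz).2 h')

/-! ### The supporting line of the tips at a maximal tip. -/

lemma inner_le_one_of_norm_eq_one {v w : Plane} (hv : ‖v‖ = 1) (hw : ‖w‖ = 1) : ⟪v, w⟫ ≤ 1 := by
  simpa [hv, hw] using real_inner_le_norm v w

lemma tip_sub_tip_inner (hβ : IsSmoothConvexCurve β LB) (s t s' t' : ℝ) (v : Plane) :
    ⟪tip α β z s' t' - tip α β z s t, v⟫ = ⟪α s' - α s, v⟫
      + gap z (ribOffset α β s' t') * ⟪rightNormal (deriv β t'), v⟫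
      - gap z (ribOffset α β s t) * ⟪rightNormal (deriv β t), v⟫ := by
  simp only [tip_eq hβ, inner_sub_left, inner_add_left, real_inner_smul_left]
  ring

/-- The height of a tip above the tangent line at the maximal tip, split into three nonpositive
parts. -/
lemma tip_sub_tip_inner_normal (hβ : IsSmoothConvexCurve β LB) (s t s' t' : ℝ) :
    ⟪tip α β z s' t' - tip α β z s t, rightNormal (deriv β t)⟫ =
      ⟪α s' - α s, rightNormal (deriv β t)⟫
      - gap z (ribOffset α β s' t') * (1 - ⟪deriv β t', deriv β t⟫)
      - (gap z (ribOffset α β s t) - gap z (ribOffset α β s' t')) := by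
  rw [tip_sub_tip_inner hβ, inner_rightNormal_rightNormal, inner_rightNormal_rightNormal,
    inner_self_of_norm_eq_one (hβ.unit_speed t)]
  ring

lemma IsMaximalRib.tip_inner_le (hα : IsSmoothConvexCurve α LA) (hβ : IsSmoothConvexCurve β LB)
    (hz : 0 < z) (h : IsMaximalRib α β z s t) {s' t' : ℝ} (h' : deriv α s' = deriv β t') :
    ⟪tip α β z s' t' - tip α β z s t, rightNormal (deriv β t)⟫ ≤ 0 := by
  rw [tip_sub_tip_inner_normal hβ]
  have h1 := h.gap_le hα hβ hz h'
  have h2 := hα.convex s' s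
  rw [h.deriv_eq hα hβ hz] at h2
  have h3 := inner_le_one_of_norm_eq_one (hβ.unit_speed t') (hβ.unit_speed t)
  have h4 := gap_pos hz (ribOffset α β s' t')
  nlinarith [mul_nonneg h4.le (sub_nonneg.2 h3)]

lemma IsMaximalRib.tip_mem_frontier (hα : IsSmoothConvexCurve α LA)
    (hβ : IsSmoothConvexCurve β LB) (hz : 0 < z) (h : IsMaximalRib α β z s t) :
    tip α β z s t ∈ frontier (convexHull ℝ (sideUnfolding α β z)) := by
  set n := rightNormal (deriv β t)
  set u := tip α β z s t
  have hmem : u ∈ convexHull ℝ (sideUnfolding α β z) :=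
    subset_convexHull _ _ ⟨s, t, h.1, rfl⟩
  have hle : ∀ v ∈ convexHull ℝ (sideUnfolding α β z), ⟪v, n⟫ ≤ ⟪u, n⟫ := by
    intro v hv
    have hc : Convex ℝ {q : Plane | ⟪q, n⟫ ≤ ⟪u, n⟫} :=
      convex_halfSpace_le ⟨fun _ _ => inner_add_left _ _ _, fun _ _ => real_inner_smul_left _ _ _⟩ _
    refine convexHull_min ?_ hc hv
    rintro _ ⟨s', t', h', rfl⟩
    have := h.tip_inner_le hα hβ hz ((isRib_iff hα hβ hz).1 h')
    rw [inner_sub_left] at this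
    rw [mem_ofPred_eq]
    linarith
  refine ⟨subset_closure hmem, fun hint => ?_⟩
  have hn : ⟪n, n⟫ = 1 := by
    rw [inner_rightNormal_rightNormal, inner_self_of_norm_eq_one (hβ.unit_speed t)]
  have hlim : Tendsto (fun r : ℝ => u + r • n) (𝓝[>] 0) (𝓝 u) := by
    have : Continuous fun r : ℝ => u + r • n := by fun_prop
    simpa using (this.tendsto 0).mono_left nhdsWithin_le_nhds
  obtain ⟨r, hr, hr0⟩ := ((hlim.eventually_mem (mem_interior_iff_mem_nhds.1 hint)).and
    self_mem_nhdsWithin).exists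
  have := hle _ hr
  rw [inner_add_left, real_inner_smul_left, hn] at this
  have hr0' : (0 : ℝ) < r := hr0
  linarith

/-! ### Mutual tangency. -/

/-- A comparison function bounding the heights of the tips from below, by attaching all top points
to the same base point. -/
lemma IsMaximalRib.hasDerivAt_comparison (hα : IsSmoothConvexCurve α LA)
    (hβ : IsSmoothConvexCurve β LB) (hz : 0 < z) (h : IsMaximalRib α β z s t) :
    HasDerivAt (fun r => ⟪α r - α s, rightNormal (deriv β t)⟫
      + gap z ⟪α r - β t, rightNormal (deriv α r)⟫ * ⟪deriv α r, deriv β t⟫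
      - gap z (ribOffset α β s t)) 0 s := by
  have hst := h.deriv_eq hα hβ hz
  set G : ℝ → ℝ := fun r => ⟪α r - α s, rightNormal (deriv β t)⟫
      + gap z ⟪α r - β t, rightNormal (deriv α r)⟫ * ⟪deriv α r, deriv β t⟫
      - gap z (ribOffset α β s t) with hG
  have hd1 := hα.hasDerivAt s
  have hd2 := (hα.differentiable_deriv s).hasDerivAt
  have hdiff : DifferentiableAt ℝ G s := by
    have h1 := (hd1.sub_const (α s)).differentiableAt
    have h2 := (hd1.sub_const (β t)).differentiableAt
    have h3 := hd2.rightNormal.differentiableAt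
    have h4 := hd2.differentiableAt
    exact ((h1.inner ℝ (differentiableAt_const _)).add
      (((differentiable_gap hz _).comp s (h2.inner ℝ h3)).mul
        (h4.inner ℝ (differentiableAt_const _)))).sub_const _
  have hmax : IsLocalMax G s := by
    refine Eventually.of_forall fun r => ?_
    have hs : G s = 0 := by
      simp only [hG]
      rw [hst, sub_self, inner_zero_left, inner_self_of_norm_eq_one (hβ.unit_speed t), ribOffset]
      ring
    rw [hs]
    obtain ⟨t', ht'⟩ := hβ.exists_deriv_eq (hα.unit_speed r)
    -- The point β t lies inside the tangent at t', so measuring from it enlarges the offset and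
    -- lowers the gap. The true base point β t' may jump across a flat part; the frozen one keeps G
    -- differentiable.
    have h1 : gap z ⟪α r - β t, rightNormal (deriv α r)⟫ ≤ gap z (ribOffset α β r t') := by
      refine gap_antitone ?_
      have := hβ.convex' t t'
      rw [ribOffset, ← ht', inner_sub_left, inner_sub_left]
      linarith
    have h2 := h.gap_le hα hβ hz ht'.symm
    have h3 := hα.convex r s
    rw [hst] at h3
    have h4 := inner_le_one_of_norm_eq_one (hα.unit_speed r) (hβ.unit_speed t)
    have h5 := gap_pos hz ⟪α r - β t, rightNormal (deriv α r)⟫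
    simp only [hG]
    nlinarith [mul_nonneg h5.le (sub_nonneg.2 h4)]
  have := hmax.deriv_eq_zero
  rw [← this]
  exact hdiff.hasDerivAt

/-- Along the ribs, the tips move from the maximal one in the direction of the tangent of the top,
up to second order terms. -/
lemma IsMaximalRib.tip_near (hα : IsSmoothConvexCurve α LA)
    (hβ : IsSmoothConvexCurve β LB) (hz : 0 < z) (h : IsMaximalRib α β z s t) {ε : ℝ} (hε : 0 < ε) :
    ∀ᶠ r in 𝓝 s, ∀ t', deriv α r = deriv β t' →
      |r - s| ≤ 2 * |⟪tip α β z r t' - tip α β z s t, deriv β t⟫| ∧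
      |⟪tip α β z r t' - tip α β z s t, rightNormal (deriv β t)⟫| ≤ ε * |r - s| := by
  have hst := h.deriv_eq hα hβ hz
  set τ := deriv β t
  have hτ : ‖τ‖ = 1 := hβ.unit_speed t
  have e1 : ∀ᶠ r in 𝓝 s, 0 < ⟪deriv α r, τ⟫ := by
    have hc : ContinuousAt (fun r => ⟪deriv α r, τ⟫) s :=
      (hα.continuous_deriv.inner continuous_const).continuousAt
    refine hc.eventually (lt_mem_nhds ?_)
    beta_reduce
    rw [hst, inner_self_of_norm_eq_one hτ]
    exact one_pos
  have e2 : ∀ᶠ r in 𝓝 s, |⟪α r - α s, τ⟫ - (r - s)| ≤ 1 / 2 * |r - s| := by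
    have hd : HasDerivAt (fun r => ⟪α r, τ⟫) 1 s := by
      have := (hα.hasDerivAt s).inner ℝ (hasDerivAt_const s τ)
      simpa [hst, inner_self_of_norm_eq_one hτ, hτ] using this
    filter_upwards [(hasDerivAt_iff_isLittleO.1 hd).bound (show (0 : ℝ) < 1 / 2 by norm_num)]
      with r hr
    simpa [inner_sub_left] using hr
  have e3 := (hasDerivAt_iff_isLittleO.1 (h.hasDerivAt_comparison hα hβ hz)).bound hε
  filter_upwards [e1, e2, e3] with r h1 h2 h3 t' ht'
  constructor
  · have hsgn : 0 ≤ ⟪α r - α s, τ⟫ * ⟪rightNormal (deriv β t'), τ⟫ := by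
      have a1 := hα.convex s r
      have a2 := hα.convex r s
      rw [hst] at a2
      rw [← neg_sub, inner_neg_left, inner_eq_frame hτ,
        inner_rightNormal_rightNormal] at a1
      rw [← ht']
      nlinarith
    have hf := gap_pos hz (ribOffset α β r t')
    have hle : |⟪α r - α s, τ⟫| ≤ |⟪tip α β z r t' - tip α β z s t, τ⟫| := by
      rw [tip_sub_tip_inner hβ, inner_self_rightNormal, mul_zero, sub_zero]
      refine sq_le_sq.1 ?_
      nlinarith [sq_nonneg (gap z (ribOffset α β r t') * ⟪rightNormal (deriv β t'), τ⟫),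
        mul_nonneg hf.le hsgn]
    have := abs_sub_abs_le_abs_sub (r - s) ⟪α r - α s, τ⟫
    rw [abs_sub_comm] at h2
    linarith
  · have hle := h.tip_inner_le hα hβ hz ht'
    have hlow : ⟪α r - α s, rightNormal τ⟫
        + gap z ⟪α r - β t, rightNormal (deriv α r)⟫ * ⟪deriv α r, τ⟫
        - gap z (ribOffset α β s t) ≤ ⟪tip α β z r t' - tip α β z s t, rightNormal τ⟫ := by
      rw [tip_sub_tip_inner hβ, inner_rightNormal_rightNormal, inner_rightNormal_rightNormal,
        inner_self_of_norm_eq_one hτ, ← ht', mul_one]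
      have : gap z ⟪α r - β t, rightNormal (deriv α r)⟫ ≤ gap z (ribOffset α β r t') := by
        refine gap_antitone ?_
        have := hβ.convex' t t'
        rw [ribOffset, ht', inner_sub_left, inner_sub_left]
        linarith
      nlinarith
    have hzero : gap z ⟪α s - β t, rightNormal (deriv α s)⟫ * ⟪deriv α s, τ⟫
        = gap z (ribOffset α β s t) := by
      rw [hst, inner_self_of_norm_eq_one hτ, mul_one, ribOffset]
    simp only [smul_zero, sub_zero, sub_self, inner_zero_left, zero_add, Real.norm_eq_abs] at h3
    rw [hzero, sub_self, sub_zero] at h3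
    rw [abs_of_nonpos hle]
    linarith [neg_abs_le (⟪α r - α s, rightNormal τ⟫
        + gap z ⟪α r - β t, rightNormal (deriv α r)⟫ * ⟪deriv α r, τ⟫
        - gap z (ribOffset α β s t))]

/-- Only ribs from nearby top points have tips close to the maximal tip. -/
lemma IsMaximalRib.exists_near_of_tip_near (hα : IsSmoothConvexCurve α LA)
    (hβ : IsSmoothConvexCurve β LB) (hz : 0 < z) (h : IsMaximalRib α β z s t) {ε : ℝ} (hε : 0 < ε) :
    ∃ δ > 0, ∀ s' t', deriv α s' = deriv β t' → ‖tip α β z s' t' - tip α β z s t‖ < δ →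
      ∃ r, |r - s| < ε ∧ deriv α r = deriv β t' ∧ tip α β z r t' = tip α β z s' t' := by
  obtain ⟨η, hη, hnear⟩ := hα.exists_near_parameter s hε
  set F := gap z (ribOffset α β s t) with hF
  have hF0 : 0 < F := gap_pos hz _
  -- At x = ‖d‖ this will bound ‖α s' - α s‖; it tends to 0 with x.
  have hcont : Continuous fun x : ℝ => |x| + √(x ^ 2 + 2 * F * |x|) := by fun_prop
  have hlim := hcont.tendsto 0
  simp only [abs_zero, ne_eq, OfNat.ofNat_ne_zero, not_false_eq_true, zero_pow, mul_zero, add_zero,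
    Real.sqrt_zero] at hlim
  obtain ⟨δ, hδ, hball⟩ := Metric.eventually_nhds_iff.1 (hlim.eventually (gt_mem_nhds hη))
  refine ⟨δ, hδ, fun s' t' hst' hd => ?_⟩
  set d := tip α β z s' t' - tip α β z s t with hdd
  set f := gap z (ribOffset α β s' t') with hf
  have hf0 : 0 < f := gap_pos hz _
  have hfF : f ≤ F := h.gap_le hα hβ hz hst'
  have hn : ∀ t, ‖rightNormal (deriv β t)‖ = 1 := fun t => by
    rw [norm_rightNormal, hβ.unit_speed]
  have hC := inner_le_one_of_norm_eq_one (hβ.unit_speed t') (hβ.unit_speed t)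
  have hA := hα.convex s' s
  rw [h.deriv_eq hα hβ hz] at hA
  have hx : -‖d‖ ≤ ⟪d, rightNormal (deriv β t)⟫ := by
    have := abs_real_inner_le_norm d (rightNormal (deriv β t))
    rw [hn, mul_one] at this
    exact (abs_le.1 this).1
  rw [hdd, tip_sub_tip_inner_normal hβ, ← hdd] at hx
  -- The three nonpositive parts sum to at least -‖d‖, so each is at most ‖d‖ in size.
  have h1 : f * (1 - ⟪deriv β t', deriv β t⟫) ≤ ‖d‖ := by linarith
  have h2 : F - f ≤ ‖d‖ := by
    have := mul_nonneg hf0.le (sub_nonneg.2 hC)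
    linarith
  -- The square equals (F - f)² + 2 f F (1 - ⟨τ', τ⟩), and f ≤ F.
  have hsq : ‖f • rightNormal (deriv β t') - F • rightNormal (deriv β t)‖ ^ 2
      ≤ ‖d‖ ^ 2 + 2 * F * ‖d‖ := by
    rw [norm_sub_sq_real, norm_smul, norm_smul, hn, hn, real_inner_smul_left,
      real_inner_smul_right, inner_rightNormal_rightNormal, Real.norm_of_nonneg hf0.le,
      Real.norm_of_nonneg hF0.le]
    nlinarith
  have hclose : ‖α s' - α s‖ < η := by
    have e : α s' - α s = d - (f • rightNormal (deriv β t') - F • rightNormal (deriv β t)) := by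
      rw [hdd, tip_eq hβ, tip_eq hβ]
      abel
    have h3 := hball (y := ‖d‖) (by simpa using hd)
    rw [abs_of_nonneg (norm_nonneg d)] at h3
    have h4 := Real.le_sqrt_of_sq_le hsq
    rw [e]
    linarith [norm_sub_le d (f • rightNormal (deriv β t') - F • rightNormal (deriv β t))]
  obtain ⟨r, hr, k, hk⟩ := hnear s' hclose
  have e1 : α s' = α r := by
    rw [hk]
    exact hα.periodic.int_mul k r
  have e2 : deriv α s' = deriv α r := by
    rw [hk]
    exact hα.periodic_deriv.int_mul k r
  exact ⟨r, hr, e2 ▸ hst', by rw [tip, tip, e1]⟩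

/-- Eliminates the rib parameter: `tip_near` with ε / 2 bounds the height by (ε / 2)|r - s|, and |r
- s| is at most twice the tangential displacement. -/
lemma IsMaximalRib.inner_normal_le_inner_tangent (hα : IsSmoothConvexCurve α LA)
    (hβ : IsSmoothConvexCurve β LB) (hz : 0 < z) (h : IsMaximalRib α β z s t) {ε : ℝ} (hε : 0 < ε) :
    ∃ δ > 0, ∀ u ∈ sideUnfolding α β z, ‖u - tip α β z s t‖ < δ →
      |⟪u - tip α β z s t, rightNormal (deriv β t)⟫|
        ≤ ε * |⟪u - tip α β z s t, deriv β t⟫| := by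
  obtain ⟨η, hη, hnear⟩ := Metric.eventually_nhds_iff.1 (h.tip_near hα hβ hz (half_pos hε))
  obtain ⟨δ, hδ, hfar⟩ := h.exists_near_of_tip_near hα hβ hz hη
  refine ⟨δ, hδ, ?_⟩
  rintro _ ⟨s', t', hrib, rfl⟩ hd
  obtain ⟨r, hr, hrt, e⟩ := hfar s' t' ((isRib_iff hα hβ hz).1 hrib) hd
  obtain ⟨h1, h2⟩ := hnear hr t' hrt
  rw [← e]
  nlinarith

/-- Near the tip, U lies in arbitrarily thin double cones about τ. The cone inequality is
homogeneous, so it survives rescaling and limits. -/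
lemma IsMaximalRib.tangentCone_subset (hα : IsSmoothConvexCurve α LA)
    (hβ : IsSmoothConvexCurve β LB) (hz : 0 < z) (h : IsMaximalRib α β z s t) :
    tangentConeAt ℝ (sideUnfolding α β z) (tip α β z s t) ⊆
      (ℝ ∙ deriv α s : Submodule ℝ Plane) := by
  intro v hv
  rw [mem_tangentConeAt_iff_exists_seq] at hv
  obtain ⟨c, d, hd, hU, hcd⟩ := hv
  have hτ := hβ.unit_speed t
  have hbound : ∀ ε > 0, |⟪v, rightNormal (deriv β t)⟫| ≤ ε * |⟪v, deriv β t⟫| := by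
    intro ε hε
    obtain ⟨δ, hδ, hle⟩ := h.inner_normal_le_inner_tangent hα hβ hz hε
    have hd' : ∀ᶠ k in atTop, ‖d k‖ < δ := by
      have := hd.norm
      rw [norm_zero] at this
      exact this.eventually (gt_mem_nhds hδ)
    have hl : Tendsto (fun k => |⟪c k • d k, rightNormal (deriv β t)⟫|) atTop
        (𝓝 |⟪v, rightNormal (deriv β t)⟫|) := (hcd.inner tendsto_const_nhds).abs
    have hr : Tendsto (fun k => ε * |⟪c k • d k, deriv β t⟫|) atTop
        (𝓝 (ε * |⟪v, deriv β t⟫|)) := (hcd.inner tendsto_const_nhds).abs.const_mul ε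
    refine le_of_tendsto_of_tendsto hl hr ?_
    filter_upwards [hd', hU] with k hk hkU
    have := hle _ hkU (by simpa using hk)
    rw [add_sub_cancel_left] at this
    rw [real_inner_smul_left, real_inner_smul_left, abs_mul, abs_mul]
    nlinarith [abs_nonneg (c k), mul_le_mul_of_nonneg_left this (abs_nonneg (c k))]
  have hzero : ⟪v, rightNormal (deriv β t)⟫ = 0 := by
    by_contra hne
    have hpos := abs_pos.2 hne
    have hb : 0 ≤ |⟪v, deriv β t⟫| := abs_nonneg _
    set B := |⟪v, deriv β t⟫|
    set A := |⟪v, rightNormal (deriv β t)⟫|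
    -- With this ε the right side is at most A / 2, which is impossible for A > 0.
    have h1 := hbound (A / (2 * (B + 1))) (by positivity)
    have h2 : A / (2 * (B + 1)) * B = A / 2 * (B / (B + 1)) := by field_simp
    have h3 : B / (B + 1) ≤ 1 := by
      rw [div_le_one (by positivity)]
      linarith
    rw [h2] at h1
    nlinarith
  rw [SetLike.mem_coe, Submodule.mem_span_singleton, h.deriv_eq hα hβ hz]
  refine ⟨⟪v, deriv β t⟫, ?_⟩
  conv_rhs => rw [frame_expansion hτ v, hzero, zero_smul, add_zero]

/-- Chords from the maximal tip are rescaled to have tangential component a; their normal component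
then vanishes in the limit. The choice T of base parameters need not be continuous. -/
lemma IsMaximalRib.subset_tangentCone (hα : IsSmoothConvexCurve α LA)
    (hβ : IsSmoothConvexCurve β LB) (hz : 0 < z) (h : IsMaximalRib α β z s t) :
    ((ℝ ∙ deriv α s : Submodule ℝ Plane) : Set Plane) ⊆
      tangentConeAt ℝ (sideUnfolding α β z) (tip α β z s t) := by
  intro v hv
  rw [SetLike.mem_coe, Submodule.mem_span_singleton, h.deriv_eq hα hβ hz] at hv
  obtain ⟨a, rfl⟩ := hv
  have hst := h.deriv_eq hα hβ hz
  have hτ := hβ.unit_speed t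
  choose T hT using fun r => hβ.exists_deriv_eq (hα.unit_speed r)
  set d : ℝ → Plane := fun r => tip α β z r (T r) - tip α β z s t with hd
  set x : ℝ → ℝ := fun r => ⟪d r, deriv β t⟫ with hx
  set y : ℝ → ℝ := fun r => ⟪d r, rightNormal (deriv β t)⟫ with hy
  have hdxy : ∀ r, d r = x r • deriv β t + y r • rightNormal (deriv β t) := fun r =>
    frame_expansion hτ (d r)
  have hle : 𝓝[≠] s ≤ 𝓝 s := nhdsWithin_le_nhds
  have hrs : Tendsto (fun r => |r - s|) (𝓝[≠] s) (𝓝 0) := by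
    have : Continuous fun r => |r - s| := by fun_prop
    simpa using (this.tendsto s).mono_left hle
  have hx0 : Tendsto x (𝓝[≠] s) (𝓝 0) := by
    -- Replacing the gap at r by its maximum removes T from the bound.
    have hb : Continuous fun r => |⟪α r - α s, deriv β t⟫|
        + gap z (ribOffset α β s t) * |⟪rightNormal (deriv α r), deriv β t⟫| := by
      have h1 := hα.continuous
      have h2 := hα.continuous_deriv
      have h3 := continuous_rightNormal
      fun_prop
    have hb' := (hb.tendsto s).mono_left hle
    simp only [sub_self, inner_zero_left, abs_zero, hst, inner_self_rightNormal, mul_zero,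
      add_zero] at hb'
    refine squeeze_zero_norm (fun r => ?_) hb'
    have h1 := h.gap_le hα hβ hz (hT r).symm
    have h2 := gap_pos hz (ribOffset α β r (T r))
    simp only [hx, hd]
    rw [tip_sub_tip_inner hβ, inner_self_rightNormal, mul_zero, sub_zero, hT, Real.norm_eq_abs]
    refine (abs_add_le _ _).trans ?_
    rw [abs_mul, abs_of_pos h2]
    gcongr
  have hyx : Tendsto (fun r => y r / x r) (𝓝[≠] s) (𝓝 0) := by
    rw [Metric.tendsto_nhds]
    intro ε hε
    filter_upwards [hle (h.tip_near hα hβ hz (show 0 < ε / 4 by positivity)),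
      self_mem_nhdsWithin] with r hr hne
    obtain ⟨h1, h2⟩ := hr (T r) (hT r).symm
    have h3 : 0 < |r - s| := abs_pos.2 (sub_ne_zero.2 hne)
    have h4 : 0 < |x r| := by linarith
    rw [dist_zero_right, norm_div, Real.norm_eq_abs, Real.norm_eq_abs, div_lt_iff₀ h4]
    have h5 : |y r| ≤ ε / 4 * |r - s| := h2
    have h6 : |r - s| ≤ 2 * |x r| := h1
    nlinarith
  have hy0 : Tendsto y (𝓝[≠] s) (𝓝 0) := by
    refine squeeze_zero_norm' ?_ hrs
    filter_upwards [hle (h.tip_near hα hβ hz one_pos)] with r hr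
    simpa using (hr (T r) (hT r).symm).2
  refine mem_tangentConeAt_of_seq (𝓝[≠] s) (fun r => a / x r) d ?_ ?_ ?_
  · have := (hx0.smul_const (deriv β t)).add (hy0.smul_const (rightNormal (deriv β t)))
    simp only [zero_smul, add_zero] at this
    exact this.congr fun r => (hdxy r).symm
  · refine Eventually.of_forall fun r => ?_
    simp only [hd, add_sub_cancel]
    exact ⟨r, T r, (isRib_iff hα hβ hz).2 (hT r).symm, rfl⟩
  · have hlim : Tendsto (fun r => a • deriv β t + (a * (y r / x r)) • rightNormal (deriv β t))
        (𝓝[≠] s) (𝓝 (a • deriv β t)) := by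
      have := ((hyx.const_mul a).smul_const (rightNormal (deriv β t))).const_add (a • deriv β t)
      simpa using this
    refine hlim.congr' ?_
    filter_upwards [hle (h.tip_near hα hβ hz one_pos), self_mem_nhdsWithin] with r hr hne
    have h1 : |r - s| ≤ 2 * |x r| := (hr (T r) (hT r).symm).1
    have h3 : 0 < |r - s| := abs_pos.2 (sub_ne_zero.2 hne)
    have h4 : x r ≠ 0 := abs_pos.1 (by linarith)
    rw [hdxy r, smul_add, smul_smul, smul_smul, div_mul_cancel₀ _ h4]
    congr 2
    ring

lemma IsMaximalRib.mutualTangency (hα : IsSmoothConvexCurve α LA)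
    (hβ : IsSmoothConvexCurve β LB) (hz : 0 < z) (h : IsMaximalRib α β z s t) :
    MutualTangency α β z s t := by
  refine ⟨(h.tangentCone_subset hα hβ hz).antisymm (h.subset_tangentCone hα hβ hz), ?_⟩
  intro σ hσ hst v hv
  apply h.tangentCone_subset hα hβ hz
  -- The derivative maps the tangent cone of the parameter line into that of the image; the vector 1
  -- goes to v.
  have hmap := hv.hasFDerivAt.hasFDerivWithinAt (s := univ) |>.mapsTo_tangent_cone
  have h1 : (1 : ℝ) ∈ tangentConeAt ℝ univ t := by
    rw [tangentConeAt_univ]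
    trivial
  have h2 := hmap h1
  rw [hst] at h2
  have h3 := tangentConeAt_mono (𝕜 := ℝ) (x := tip α β z s t)
    (show (fun t' => tip α β z (σ t') t') '' univ ⊆ sideUnfolding α β z from by
      rintro _ ⟨t', -, rfl⟩
      exact ⟨σ t', t', hσ t', rfl⟩) h2
  simpa using h3

/-! ### Unfolded ribs do not overlap each other or the base. -/

/-- The length of the component of the unfolded rib normal to the base. -/
noncomputable def ribHeight (α β : ℝ → Plane) (z s t : ℝ) : ℝ :=
  √(ribOffset α β s t ^ 2 + z ^ 2)

lemma ribHeight_pos (hz : 0 < z) (s t : ℝ) : 0 < ribHeight α β z s t :=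
  Real.sqrt_pos.2 (by positivity)

lemma gap_ribOffset (s t : ℝ) :
    gap z (ribOffset α β s t) = ribHeight α β z s t - ribOffset α β s t := rfl

lemma space_ext {q q' : Space} (h : shadow q = shadow q') (h2 : q 2 = q' 2) : q = q' := by
  have h0 := congrArg (fun v : Plane => v 0) h
  have h1 := congrArg (fun v : Plane => v 1) h
  ext i
  fin_cases i <;> assumption

lemma shadow_add (q q' : Space) : shadow (q + q') = shadow q + shadow q' := by
  ext i
  fin_cases i <;> rfl

lemma shadow_smul (c : ℝ) (q : Space) : shadow (c • q) = c • shadow q := by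
  ext i
  fin_cases i <;> rfl

lemma shadow_lift (z : ℝ) (p : Plane) : shadow (lift z p) = p := by
  ext i
  fin_cases i <;> rfl

lemma lift_apply_two (z : ℝ) (p : Plane) : lift z p 2 = z := rfl

/-- `PointOnRib α β z s t q l p`: the point `q` divides the rib in the ratio given by `l`, and `p`
is its unfolded image. -/
structure PointOnRib (α β : ℝ → Plane) (z s t : ℝ) (q : Space) (l : ℝ) (p : Plane) : Prop where
  nonneg : 0 ≤ l
  le_one : l ≤ 1
  height : q 2 = l * z
  shadow_eq : shadow q = β t + l • (α s - β t)
  image_eq : p = β t + (l * ⟪α s - β t, deriv β t⟫) • deriv β t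
    + (l * ribHeight α β z s t) • rightNormal (deriv β t)

lemma exists_pointOnRib {q : Space} (hq : q ∈ rib α β z s t) :
    ∃ l, PointOnRib α β z s t q l (unfoldPoint β t q) := by
  obtain ⟨l, m, hl, hm, hlm, rfl⟩ := hq
  have hs : shadow (l • lift z (α s) + m • lift 0 (β t)) = β t + l • (α s - β t) := by
    rw [shadow_add, shadow_smul, shadow_smul, shadow_lift, shadow_lift, ← sub_eq_of_eq_add' hlm.symm]
    module
  have h2 : (l • lift z (α s) + m • lift 0 (β t)) 2 = l * z := by
    simp [lift_apply_two]
  refine ⟨l, hl, by linarith, h2, hs, ?_⟩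
  rw [unfoldPoint, hs, h2, add_sub_cancel_left, real_inner_smul_left, real_inner_smul_left,
    ribHeight, ribOffset]
  congr 2
  rw [mul_pow, mul_pow, ← mul_add, Real.sqrt_mul (sq_nonneg l), Real.sqrt_sq hl]

namespace PointOnRib

variable {q q' : Space} {p : Plane} {l l' s' t' : ℝ}

lemma image_eq_add_smul_tip (h : PointOnRib α β z s t q l p) :
    p = β t + l • (tip α β z s t - β t) := by
  rw [h.image_eq, tip, unfoldPoint, shadow_lift, lift_apply_two, ribHeight, ribOffset]
  module

lemma inner_normal (hβ : IsSmoothConvexCurve β LB) (h : PointOnRib α β z s t q l p) :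
    ⟪p, rightNormal (deriv β t)⟫ = ⟪β t, rightNormal (deriv β t)⟫ + l * ribHeight α β z s t := by
  rw [h.image_eq, inner_add_left, inner_add_left, real_inner_smul_left, real_inner_smul_left,
    inner_rightNormal_self, inner_rightNormal_rightNormal,
    inner_self_of_norm_eq_one (hβ.unit_speed t)]
  ring

/-- An unfolded rib leaves its base endpoint strictly to the outside of the tangent there. -/
lemma eq_lift_of_mem_region (hβ : IsSmoothConvexCurve β LB) (hz : 0 < z)
    (h : PointOnRib α β z s t q l p) (hp : p ∈ region β) : l = 0 ∧ q = lift 0 p := by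
  have h1 := hβ.inner_rightNormal_le_of_mem_region hp t
  rw [h.inner_normal hβ] at h1
  have h2 := ribHeight_pos (α := α) (β := β) hz s t
  have hl : l = 0 := by nlinarith [h.nonneg]
  refine ⟨hl, space_ext ?_ ?_⟩
  · rw [h.shadow_eq, shadow_lift, h.image_eq, hl]
    simp
  · rw [h.height, lift_apply_two, hl, zero_mul]

/-- If two unfolded ribs meet, convexity of the base and of the top bounds the height of the first
one at the meeting point. -/
lemma height_le (hα : IsSmoothConvexCurve α LA) (hβ : IsSmoothConvexCurve β LB)
    (h : PointOnRib α β z s t q l p) (hst : deriv α s = deriv β t)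
    (h' : PointOnRib α β z s' t' q' l' p) :
    l * ribHeight α β z s t ≤ l' * (ribOffset α β s t
      + ⟪deriv β t', deriv β t⟫ * gap z (ribOffset α β s' t')) := by
  set n := rightNormal (deriv β t) with hn
  have e := h.inner_normal hβ
  have e' : ⟪p, n⟫ = ⟪β t', n⟫ + l' * (⟪α s' - β t', deriv β t'⟫ * ⟪deriv β t', n⟫)
      + l' * ribHeight α β z s' t' * ⟪deriv β t', deriv β t⟫ := by
    rw [h'.image_eq, inner_add_left, inner_add_left, real_inner_smul_left, real_inner_smul_left,
      hn, inner_rightNormal_rightNormal]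
    ring
  -- With f' the gap of the second rib and n' its normal, p = (1 - l') β t' + l' (α s' + f' n').
  -- Along n, β t' is bounded by β t and α s' by α s.
  have hb := hβ.convex' t' t
  have ha := hα.convex' s' s
  have e1 : ⟪α s', n⟫ = ⟪β t', n⟫ + ⟪α s' - β t', deriv β t'⟫ * ⟪deriv β t', n⟫
      + ribOffset α β s' t' * ⟪deriv β t', deriv β t⟫ := by
    have := inner_eq_frame (hβ.unit_speed t') (α s' - β t') n
    rw [inner_sub_left, real_inner_comm (deriv β t') n, hn, inner_rightNormal_rightNormal,
      real_inner_comm (deriv β t') (deriv β t)] at this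
    rw [ribOffset, hn]
    linarith
  have e2 : ⟪α s, n⟫ = ⟪β t, n⟫ + ribOffset α β s t := by
    rw [ribOffset, inner_sub_left]
    ring
  rw [hst, ← hn, e1, e2] at ha
  rw [← hn] at hb e
  rw [gap_ribOffset]
  have hl := h'.nonneg
  have hl1 := h'.le_one
  nlinarith [mul_nonneg (sub_nonneg.2 hl1) (sub_nonneg.2 hb), mul_nonneg hl (sub_nonneg.2 ha)]

lemma deriv_eq_of_meet (hα : IsSmoothConvexCurve α LA) (hβ : IsSmoothConvexCurve β LB) (hz : 0 < z)
    (h : PointOnRib α β z s t q l p) (hst : deriv α s = deriv β t)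
    (h' : PointOnRib α β z s' t' q' l' p) (hst' : deriv α s' = deriv β t')
    (hl : 0 < l) (hl' : 0 < l') : deriv β t' = deriv β t := by
  have hC := inner_le_one_of_norm_eq_one (hβ.unit_speed t') (hβ.unit_speed t)
  rcases hC.eq_or_lt with hC | hC
  · exact (inner_eq_one_iff_of_norm_eq_one (hβ.unit_speed t') (hβ.unit_speed t)).1 hC
  exfalso
  have hA := h.height_le hα hβ hst h'
  have hB := h'.height_le hα hβ hst' h
  rw [real_inner_comm] at hB
  have hf := gap_pos hz (ribOffset α β s t)
  have hf' := gap_pos hz (ribOffset α β s' t')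
  have hY := ribHeight_pos (α := α) (β := β) hz s t
  have hY' := ribHeight_pos (α := α) (β := β) hz s' t'
  have key := sqrt_sub_sqrt_mul_le (z := z) (ribOffset α β s t) (ribOffset α β s' t')
  change (ribOffset α β s t - ribOffset α β s' t') * (ribHeight α β z s t - ribHeight α β z s' t')
    ≤ _ at key
  have hA' : l * ribHeight α β z s t
      < l' * (ribOffset α β s t + gap z (ribOffset α β s' t')) :=
    hA.trans_lt (mul_lt_mul_of_pos_left (by nlinarith) hl')
  have hB' : l' * ribHeight α β z s' t'
      < l * (ribOffset α β s' t' + gap z (ribOffset α β s t)) :=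
    hB.trans_lt (mul_lt_mul_of_pos_left (by nlinarith) hl)
  rw [gap_ribOffset] at hA' hB'
  generalize ribHeight α β z s t = Y at *
  generalize ribHeight α β z s' t' = Y' at *
  generalize ribOffset α β s t = c at *
  generalize ribOffset α β s' t' = c' at *
  have hm := mul_lt_mul'' hA' hB' (by positivity) (by positivity)
  -- The product equals Y Y' + (c - c')(Y - Y') - (c - c')², so `key` applies.
  have : (c + (Y' - c')) * (c' + (Y - c)) ≤ Y * Y' := by linarith
  nlinarith [mul_le_mul_of_nonneg_left this (mul_pos hl hl').le]

/-- Ribs over flat parts can cross while sharing a tangent. They then have the same offset and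
height, so p determines l, and q is recovered from p by a shift along the common normal. -/
lemma eq_of_meet (hα : IsSmoothConvexCurve α LA) (hβ : IsSmoothConvexCurve β LB) (hz : 0 < z)
    (h : PointOnRib α β z s t q l p) (hst : deriv α s = deriv β t)
    (h' : PointOnRib α β z s' t' q' l' p) (hst' : deriv α s' = deriv β t') : q = q' := by
  have base : ∀ {s t q p}, PointOnRib α β z s t q 0 p → p ∈ region β := by
    intro s t q p h
    rw [h.image_eq]
    simpa [region] using subset_convexHull ℝ _ (mem_range_self t)
  rcases h.nonneg.eq_or_lt with rfl | hl
  · rw [(h.eq_lift_of_mem_region hβ hz (base h)).2, (h'.eq_lift_of_mem_region hβ hz (base h)).2]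
  rcases h'.nonneg.eq_or_lt with rfl | hl'
  · rw [(h.eq_lift_of_mem_region hβ hz (base h')).2, (h'.eq_lift_of_mem_region hβ hz (base h')).2]
  have hτ := h.deriv_eq_of_meet hα hβ hz hst h' hst' hl hl'
  have hb : ⟪β t', rightNormal (deriv β t)⟫ = ⟪β t, rightNormal (deriv β t)⟫ :=
    (hβ.convex' t' t).antisymm (by simpa only [hτ] using hβ.convex' t t')
  have ha : ⟪α s', rightNormal (deriv β t)⟫ = ⟪α s, rightNormal (deriv β t)⟫ := by
    have h1 := hα.convex' s' s
    have h2 := hα.convex' s s'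
    rw [hst] at h1
    rw [hst', hτ] at h2
    exact h1.antisymm h2
  have hc : ribOffset α β s' t' = ribOffset α β s t := by
    rw [ribOffset, ribOffset, hτ, inner_sub_left, inner_sub_left, ha, hb]
  have hY : ribHeight α β z s' t' = ribHeight α β z s t := by rw [ribHeight, ribHeight, hc]
  have hll : l = l' := by
    have e := h.inner_normal hβ
    have e' := h'.inner_normal hβ
    rw [hτ, e, hb, hY] at e'
    exact mul_right_cancel₀ (ribHeight_pos (α := α) (β := β) hz s t).ne' (by linarith)
  have hsh : ∀ {s t q l}, PointOnRib α β z s t q l p → shadow q = p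
      - (l * gap z (ribOffset α β s t)) • rightNormal (deriv β t) := by
    intro s t q l h
    rw [h.image_eq_add_smul_tip, tip_eq hβ, h.shadow_eq]
    module
  refine space_ext ?_ (by rw [h.height, h'.height, hll])
  rw [hsh h, hsh h', hτ, hc, hll]

end PointOnRib

/-! ### The flipped top, and nonoverlap of the whole unfolding. -/

lemma flipOut_sub_tip_inner_tangent (hβ : IsSmoothConvexCurve β LB) (p : Plane) :
    ⟪flipOut α β z s t p - tip α β z s t, deriv β t⟫ = ⟪p - α s, deriv β t⟫ := by
  have : flipOut α β z s t p - tip α β z s t = ⟪p - α s, deriv β t⟫ • deriv β t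
      - ⟪p - α s, rightNormal (deriv β t)⟫ • rightNormal (deriv β t) := by
    rw [flipOut]
    abel
  rw [this, inner_sub_left, real_inner_smul_left, real_inner_smul_left,
    inner_self_rightNormal, inner_self_of_norm_eq_one (hβ.unit_speed t)]
  ring

lemma flipOut_sub_tip_inner_normal (hβ : IsSmoothConvexCurve β LB) (p : Plane) :
    ⟪flipOut α β z s t p - tip α β z s t, rightNormal (deriv β t)⟫
      = -⟪p - α s, rightNormal (deriv β t)⟫ := by
  have : flipOut α β z s t p - tip α β z s t = ⟪p - α s, deriv β t⟫ • deriv β t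
      - ⟪p - α s, rightNormal (deriv β t)⟫ • rightNormal (deriv β t) := by
    rw [flipOut]
    abel
  rw [this, inner_sub_left, real_inner_smul_left, real_inner_smul_left,
    inner_rightNormal_self, inner_rightNormal_rightNormal,
    inner_self_of_norm_eq_one (hβ.unit_speed t)]
  ring

lemma flipOut_injective (hβ : IsSmoothConvexCurve β LB) :
    Function.Injective (flipOut α β z s t) := by
  intro p p' h
  have h1 := flipOut_sub_tip_inner_tangent (α := α) (z := z) (s := s) (t := t) hβ p
  have h2 := flipOut_sub_tip_inner_normal (α := α) (z := z) (s := s) (t := t) hβ p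
  rw [h, flipOut_sub_tip_inner_tangent hβ] at h1
  rw [h, flipOut_sub_tip_inner_normal hβ, neg_inj] at h2
  exact (sub_left_injective (frame_ext (hβ.unit_speed t) h1 h2)).symm

lemma tip_inner_normal (hβ : IsSmoothConvexCurve β LB) (s t : ℝ) :
    ⟪tip α β z s t, rightNormal (deriv β t)⟫
      = ⟪β t, rightNormal (deriv β t)⟫ + ribHeight α β z s t := by
  rw [tip_eq hβ, inner_add_left, real_inner_smul_left, inner_rightNormal_rightNormal,
    inner_self_of_norm_eq_one (hβ.unit_speed t), gap_ribOffset, ribOffset, inner_sub_left]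
  ring

/-- The flip reverses the normal coordinate, so the top, which lay inside its tangent, ends up
beyond the supporting line of the tips. -/
lemma tip_inner_le_flipOut (hα : IsSmoothConvexCurve α LA) (hβ : IsSmoothConvexCurve β LB)
    (hst : deriv α s = deriv β t) {p : Plane} (hp : p ∈ region α) :
    ⟪tip α β z s t, rightNormal (deriv β t)⟫
      ≤ ⟪flipOut α β z s t p, rightNormal (deriv β t)⟫ := by
  have h1 := flipOut_sub_tip_inner_normal (α := α) (z := z) (s := s) (t := t) hβ p
  have h2 := hα.inner_rightNormal_le_of_mem_region hp s
  rw [hst] at h2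
  rw [inner_sub_left, inner_sub_left] at h1
  linarith

lemma flipOut_notMem_region (hα : IsSmoothConvexCurve α LA) (hβ : IsSmoothConvexCurve β LB)
    (hz : 0 < z) (hst : deriv α s = deriv β t) {p : Plane} (hp : p ∈ region α) :
    flipOut α β z s t p ∉ region β := by
  intro h
  have h1 := hβ.inner_rightNormal_le_of_mem_region h t
  have h2 := tip_inner_le_flipOut (z := z) hα hβ hst hp
  rw [tip_inner_normal hβ] at h2
  linarith [ribHeight_pos (α := α) (β := β) hz s t]

/-- The flipped top meets the unfolded ribs only along the part of the top which stays attached. -/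
lemma IsMaximalRib.eq_lift_of_pointOnRib (hα : IsSmoothConvexCurve α LA)
    (hβ : IsSmoothConvexCurve β LB) (hz : 0 < z) (h : IsMaximalRib α β z s t) {p : Plane}
    (hp : p ∈ region α) {s' t' l : ℝ} {q : Space} (hst' : deriv α s' = deriv β t')
    (hq : PointOnRib α β z s' t' q l (flipOut α β z s t p)) : q = lift z p := by
  have hst := h.deriv_eq hα hβ hz
  set n := rightNormal (deriv β t) with hn
  have hY := ribHeight_pos (α := α) (β := β) hz s t
  have h1 := tip_inner_le_flipOut (z := z) hα hβ hst hp
  have h2 := h.tip_inner_le hα hβ hz hst'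
  have h3 := hβ.convex' t' t
  have h4 := tip_inner_normal (α := α) (z := z) hβ s t
  rw [← hn] at h1 h2 h3 h4
  rw [inner_sub_left] at h2
  have h5 : ⟪flipOut α β z s t p, n⟫ = (1 - l) * ⟪β t', n⟫ + l * ⟪tip α β z s' t', n⟫ := by
    rw [hq.image_eq_add_smul_tip, inner_add_left, real_inner_smul_left, inner_sub_left]
    ring
  -- For l < 1 the base endpoint, strictly below the supporting line, pulls the point strictly below
  -- it.
  have hl : l = 1 := by
    refine hq.le_one.antisymm ?_
    by_contra! hl
    nlinarith [mul_le_mul_of_nonneg_left h3 (sub_nonneg.2 hl.le),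
      mul_le_mul_of_nonneg_left h2 hq.nonneg, mul_pos (sub_pos.2 hl) hY]
  have hu : flipOut α β z s t p = tip α β z s' t' := by
    rw [hq.image_eq_add_smul_tip, hl]
    module
  have h6 := tip_sub_tip_inner_normal (α := α) (z := z) hβ s t s' t'
  have h7 := flipOut_sub_tip_inner_normal (α := α) (z := z) (s := s) (t := t) hβ p
  have h8 := flipOut_sub_tip_inner_tangent (α := α) (z := z) (s := s) (t := t) hβ p
  rw [← hn] at h6 h7
  rw [hu] at h1 h7 h8
  have hg := gap_pos hz (ribOffset α β s' t')
  have hg' := h.gap_le hα hβ hz hst'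
  have hC := inner_le_one_of_norm_eq_one (hβ.unit_speed t') (hβ.unit_speed t)
  have ha := hα.convex s' s
  rw [hst, ← hn] at ha
  have hpr := mul_nonneg hg.le (sub_nonneg.2 hC)
  have hzero : ⟪tip α β z s' t' - tip α β z s t, n⟫ = 0 := by
    rw [inner_sub_left]
    linarith
  rw [hzero] at h6 h7
  -- The height is zero, so all three nonpositive parts vanish. As the gap is positive, the tangents
  -- agree.
  have hC1 : ⟪deriv β t', deriv β t⟫ = 1 := by nlinarith
  have hτ := (inner_eq_one_iff_of_norm_eq_one (hβ.unit_speed t') (hβ.unit_speed t)).1 hC1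
  have hpa : p - α s = α s' - α s := by
    refine frame_ext (hβ.unit_speed t) ?_ ?_
    · rw [← h8, tip_sub_tip_inner hβ, hτ, inner_self_rightNormal]
      ring
    · rw [← hn]
      linarith
  have hpa' : p = α s' := sub_left_injective hpa
  refine space_ext ?_ ?_
  · rw [hq.shadow_eq, shadow_lift, hl, hpa']
    module
  · rw [hq.height, lift_apply_two, hl, one_mul]

lemma IsMaximalRib.nonoverlapping (hα : IsSmoothConvexCurve α LA)
    (hβ : IsSmoothConvexCurve β LB) (hz : 0 < z) (h : IsMaximalRib α β z s t) :
    Nonoverlapping α β z s t := by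
  have hst := h.deriv_eq hα hβ hz
  intro q q' p hq hq'
  cases hq with
  | base _ hp =>
    cases hq' with
    | base => rfl
    | side s' t' hr _ hqr =>
      obtain ⟨l, hl⟩ := exists_pointOnRib hqr
      exact (hl.eq_lift_of_mem_region hβ hz hp).2.symm
    | top r hr => exact absurd hp (flipOut_notMem_region hα hβ hz hst hr)
  | side s₁ t₁ hr₁ _ hq₁ =>
    obtain ⟨l₁, hl₁⟩ := exists_pointOnRib hq₁
    generalize unfoldPoint β t₁ q = p' at hl₁ hq'
    cases hq' with
    | base _ hp => exact (hl₁.eq_lift_of_mem_region hβ hz hp).2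
    | side s₂ t₂ hr₂ _ hq₂ =>
      obtain ⟨l₂, hl₂⟩ := exists_pointOnRib hq₂
      exact hl₁.eq_of_meet hα hβ hz ((isRib_iff hα hβ hz).1 hr₁) hl₂ ((isRib_iff hα hβ hz).1 hr₂)
    | top r hr => exact h.eq_lift_of_pointOnRib hα hβ hz hr ((isRib_iff hα hβ hz).1 hr₁) hl₁
  | top r hr =>
    generalize hp' : flipOut α β z s t r = p' at hq'
    cases hq' with
    | base _ hp =>
      rw [← hp'] at hp
      exact absurd hp (flipOut_notMem_region hα hβ hz hst hr)
    | side s₂ t₂ hr₂ _ hq₂ =>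
      obtain ⟨l₂, hl₂⟩ := exists_pointOnRib hq₂
      rw [← hp'] at hl₂
      exact (h.eq_lift_of_pointOnRib hα hβ hz hr ((isRib_iff hα hβ hz).1 hr₂) hl₂).symm
    | top r' hr' => rw [flipOut_injective hβ hp']

theorem mainTheorem1 (α β : ℝ → Plane) (LA LB z : ℝ)
    (hα : IsSmoothConvexCurve α LA) (hβ : IsSmoothConvexCurve β LB) (hz : 0 < z) :
    (∃ s t, IsMaximalRib α β z s t) ∧
    ∀ s t, IsMaximalRib α β z s t →
      MutualTangency α β z s t ∧
      tip α β z s t ∈ frontier (convexHull ℝ (sideUnfolding α β z)) ∧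
      Nonoverlapping α β z s t :=
  ⟨exists_isMaximalRib hα hβ hz, fun _ _ h =>
    ⟨h.mutualTangency hα hβ hz, h.tip_mem_frontier hα hβ hz, h.nonoverlapping hα hβ hz⟩⟩
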